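/- Let $N\ge 1$, let $\Delta_N=\{x\in\mathbb{R}^N : x_i\ge 0,\ \sum_i x_i=1\}$, and let $\eta>0$, $L>0$ and a number of periods $T$ be given. Let $F$ be a probability distribution on $\mathbb{R}^N$ (the common law of the shock vectors $\epsilon_t$), with zero mean, absolutely continuous with respect to Lebesgue measure and with full support $\mathbb{R}^N$. Define the social surplus function $$\varphi(\theta)=\mathbb{E}_{\epsilon\sim F}\Big[\max_{1\le i\le N}(\theta_i+\eta\,\epsilon_i)\Big],\qquad \theta\in\mathbb{R}^N,$$ and the regularizer $$\mathcal{R}(x)=\eta\,\varphi^*(x;\eta),\qquad \varphi^*(x;\eta)=\sup_{\theta\in\mathbb{R}^N}\Big\{\langle \theta/\eta,x\rangle-\mathbb{E}_{\epsilon\sim F}\Big[\max_{1\le i\le N}(\theta_i/\eta+\epsilon_i)\Big]\Big\}\in(-\infty,\infty].$$ Let $u_1,\dots,u_T\in\mathbb{R}^N$ be any realized payoff vectors, put $\theta_0=0$ and $\theta_t=u_t+\theta_{t-1}$, and assume that for $t=1,\dots,T$ the Hessian of $\varphi$ at $\theta_t$ exists and satisfies $2\,\mathrm{Tr}(\nabla^2\varphi(\theta_t))\le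 L/\eta$. Consider two algorithms facing these payoffs: * the Social Surplus Algorithm (SSA): $x_1=\nabla\varphi(0)$ and $x_{t+1}=\nabla\varphi(\theta_t)$ for $t=1,\dots,T$; * Follow The Regularized Leader (FTRL): $x_1=\arg\max_{x\in\Delta_N}\{-\mathcal{R}(x)\}$ and $x_{t+1}=\arg\max_{x\in\Delta_N}\{\langle\theta_t,x\rangle-\mathcal{R}(x)\}$ for $t=1,\dots,T$. Then $\mathcal{R}$ is the convex conjugate of $\varphi$, that is, $\mathcal{R}(x)=\sup_{\theta\in\mathbb{R}^N}\{\langle\theta,x\rangle-\varphi(\theta)\}$ for every $x\in\mathbb{R}^N$. Both algorithms are well defined (the gradients exist, and each maximization problem has exactly one solution). They are equivalent: a sequence $x_1,\dots,x_{T+1}$ is produced by the SSA if and only if it is produced by FTRL, so both produce the same sequence of choice probabilities. -/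

import Mathlib

namespace RUMODP

noncomputable section

/-- Payoff, shock and choice vectors: `ℝ^N` with its standard inner product. -/
abbrev Vec (N : ℕ) : Type := EuclideanSpace ℝ (Fin N)

/-- The simplex of probability vectors over the alternatives `{1, …, N}`. -/
def simplex (N : ℕ) : Set (Vec N) :=
  {x | (∀ i, 0 ≤ x i) ∧ ∑ i, x i = 1}

/-- The condition on the common law `F` of the shock vectors `ε_t`: a probability distribution
on `ℝ^N` with (finite and) zero mean, absolutely continuous with respect to Lebesgue measure,
and with full support. -/
structure ShockAssumption {N : ℕ} (F : MeasureTheory.Measure (Vec N)) : Prop where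
  isProbability : MeasureTheory.IsProbabilityMeasure F
  integrable : ∀ i, MeasureTheory.Integrable (fun e : Vec N => e i) F
  zero_mean : ∀ i, ∫ e, e i ∂F = 0
  absolutelyContinuous : F.AbsolutelyContinuous MeasureTheory.volume
  full_support : F.IsOpenPosMeasure

/-- The social surplus function with parameter `η`:
`φ(θ) = E_ε (max_i (θ_i + η ε_i))`, with `ε` distributed according to `F`. -/
def socialSurplus {N : ℕ} (F : MeasureTheory.Measure (Vec N)) (η : ℝ) (θ : Vec N) : ℝ :=
  ∫ e, (⨆ i, (θ i + η * e i)) ∂F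

/-- Cumulative payoffs: `θ_0 = 0`, `θ_t = u_t + θ_{t-1}`. -/
def cumPayoff {N : ℕ} (u : ℕ → Vec N) : ℕ → Vec N
  | 0 => 0
  | t + 1 => u (t + 1) + cumPayoff u t

/-- The Hessian of `f` at `θ`, as the linear map that is the derivative of the gradient. -/
def hessian {N : ℕ} (f : Vec N → ℝ) (θ : Vec N) : Vec N →ₗ[ℝ] Vec N :=
  (fderiv ℝ (gradient f) θ : Vec N →L[ℝ] Vec N)

/-- For `t = 1, …, T` the Hessian of the social surplus function at `θ_t` exists and
`2 Tr(∇²φ(θ_t)) ≤ L / η`. -/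
def HessianAssumption {N : ℕ} (F : MeasureTheory.Measure (Vec N)) (η L : ℝ) (T : ℕ)
    (u : ℕ → Vec N) : Prop :=
  ∀ t, 1 ≤ t → t ≤ T →
    DifferentiableAt ℝ (gradient (socialSurplus F η)) (cumPayoff u t) ∧
    2 * LinearMap.trace ℝ (Vec N) (hessian (socialSurplus F η) (cumPayoff u t)) ≤ L / η

/-- The convex conjugate `f*(x) = sup_θ (⟨θ, x⟩ - f(θ))`, with values in `(-∞, ∞]`. -/
def convexConjugate {N : ℕ} (f : Vec N → ℝ) (x : Vec N) : EReal :=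
  ⨆ θ : Vec N, ((inner ℝ θ x - f θ : ℝ) : EReal)

/-- The regularizer `R(x) = η φ*(x; η)`, where `φ*(x; η) = sup_θ (⟨θ/η, x⟩ - φ(θ/η))` and
`φ(θ/η) = E_ε (max_i (θ_i/η + ε_i))`. As `θ/η` runs over all of `ℝ^N`, `φ*(·; η)` is the
conjugate of the social surplus function with unit parameter. -/
def regularizer {N : ℕ} (F : MeasureTheory.Measure (Vec N)) (η : ℝ) (x : Vec N) : EReal :=
  (η : EReal) * convexConjugate (socialSurplus F 1) x

/-- `x = argmax_{y ∈ S} g(y)`: `x` is the one and only maximizer of `g` on `S`. -/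
def IsArgmax {N : ℕ} (g : Vec N → EReal) (S : Set (Vec N)) (x : Vec N) : Prop :=
  x ∈ S ∧ (∀ y ∈ S, g y ≤ g x) ∧ ∀ z ∈ S, (∀ y ∈ S, g y ≤ g z) → z = x

/-- `x_1, …, x_{T+1}` are the choices of the Social Surplus Algorithm against the payoffs
`u_1, …, u_T`: `x_1 = ∇φ(0)` and `x_{t+1} = ∇φ(θ_t)` for `t = 1, …, T`. -/
structure IsSSARun {N : ℕ} (F : MeasureTheory.Measure (Vec N)) (η : ℝ) (T : ℕ)
    (u x : ℕ → Vec N) : Prop where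
  init : HasGradientAt (socialSurplus F η) (x 1) 0
  step : ∀ t, 1 ≤ t → t ≤ T →
    HasGradientAt (socialSurplus F η) (x (t + 1)) (cumPayoff u t)

/-- `x_1, …, x_{T+1}` are the choices of Follow The Regularized Leader with regularizer `R`
against the payoffs `u_1, …, u_T`: `x_1 = argmax_{x ∈ Δ_N} (-R(x))` and
`x_{t+1} = argmax_{x ∈ Δ_N} (⟨θ_t, x⟩ - R(x))` for `t = 1, …, T`. -/
structure IsFTRLRun {N : ℕ} (R : Vec N → EReal) (T : ℕ) (u x : ℕ → Vec N) : Prop where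
  init : IsArgmax (fun y => -R y) (simplex N) (x 1)
  step : ∀ t, 1 ≤ t → t ≤ T →
    IsArgmax (fun y => ((inner ℝ (cumPayoff u t) y : ℝ) : EReal) - R y) (simplex N) (x (t + 1))

end

end RUMODP

namespace RUMODP

open MeasureTheory Filter Topology

noncomputable section

/-! ### Convex conjugates and the Fenchel–Young inequality -/

section Conjugate

/-! The equivalence is Fenchel duality. If a convex `φ` is differentiable at `θ`, its gradient there
is the only point giving equality in Fenchel–Young, hence the only maximizer of `⟨θ, ·⟩ - φ*`
(`isArgmax_of_hasGradientAt`). Rescaling `θ` shows that the regularizer is `φ*`. The gradient lies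
in the simplex (`mem_simplex_of_hasGradientAt`), so the constraint costs nothing. Differentiability
of `φ` at every point (`differentiableAt_socialSurplus`) comes from absolute continuity: ties
between alternatives are null events, and off them the maximum is locally affine in `θ`. -/

theorem coe_mul_iSup {ι : Sort*} {a : ℝ} (ha : 0 < a) (g : ι → EReal) :
    (a : EReal) * ⨆ i, g i = ⨆ i, (a : EReal) * g i := by
  have h0 : (0 : EReal) ≤ (a : EReal) := by exact_mod_cast ha.le
  have h0' : (0 : EReal) ≤ ((a⁻¹ : ℝ) : EReal) := by exact_mod_cast (inv_pos.2 ha).le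
  have h1 : (a : EReal) * ((a⁻¹ : ℝ) : EReal) = 1 := by
    rw [← EReal.coe_mul, mul_inv_cancel₀ ha.ne', EReal.coe_one]
  have h2 : ((a⁻¹ : ℝ) : EReal) * (a : EReal) = 1 := by rw [mul_comm, h1]
  apply le_antisymm
  · have h : ⨆ i, g i ≤ ((a⁻¹ : ℝ) : EReal) * ⨆ i, (a : EReal) * g i := by
      refine iSup_le fun i => ?_
      calc g i = ((a⁻¹ : ℝ) : EReal) * ((a : EReal) * g i) := by rw [← mul_assoc, h2, one_mul]
        _ ≤ _ := mul_le_mul_of_nonneg_left (le_iSup (fun i => (a : EReal) * g i) i) h0'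
    calc (a : EReal) * ⨆ i, g i
        ≤ (a : EReal) * (((a⁻¹ : ℝ) : EReal) * ⨆ i, (a : EReal) * g i) :=
          mul_le_mul_of_nonneg_left h h0
      _ = _ := by rw [← mul_assoc, h1, one_mul]
  · exact iSup_le fun i => mul_le_mul_of_nonneg_left (le_iSup g i) h0

variable {N : ℕ}

/-- A differentiable convex function lies above its tangent planes. -/
theorem add_inner_le_of_hasGradientAt {f : Vec N → ℝ} (hf : ConvexOn ℝ Set.univ f) {p θ : Vec N}
    (hp : HasGradientAt f p θ) (ξ : Vec N) : f θ + inner ℝ p (ξ - θ) ≤ f ξ := by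
  -- On the line through `θ` and `ξ`, the derivative at 0 is at most the slope over `[0, 1]`.
  have hc : ConvexOn ℝ Set.univ (f ∘ AffineMap.lineMap (k := ℝ) θ ξ) := by
    simpa using hf.comp_affineMap (AffineMap.lineMap (k := ℝ) θ ξ)
  have hd : HasDerivAt (f ∘ AffineMap.lineMap (k := ℝ) θ ξ) (inner ℝ p (ξ - θ)) 0 := by
    have h1 : HasFDerivAt f (InnerProductSpace.toDual ℝ (Vec N) p)
        (AffineMap.lineMap (k := ℝ) θ ξ (0 : ℝ)) := by
      simpa using hp.hasFDerivAt
    simpa using h1.comp_hasDerivAt (0 : ℝ) (AffineMap.hasDerivAt_lineMap (a := θ) (b := ξ))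
  have h := hc.le_slope_of_hasDerivAt (Set.mem_univ _) (Set.mem_univ _) zero_lt_one hd
  simp only [slope_def_field, Function.comp_apply, AffineMap.lineMap_apply_one,
    AffineMap.lineMap_apply_zero, sub_zero, div_one] at h
  linarith

/-- The only subgradient at a point of differentiability is the gradient. -/
theorem eq_of_hasGradientAt_of_subgradient {f : Vec N → ℝ} {p θ z : Vec N}
    (hp : HasGradientAt f p θ) (hz : ∀ ξ, inner ℝ ξ z - f ξ ≤ inner ℝ θ z - f θ) : z = p := by
  have hd : HasFDerivAt (fun ξ => f ξ - InnerProductSpace.toDual ℝ (Vec N) z ξ)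
      (InnerProductSpace.toDual ℝ (Vec N) p - InnerProductSpace.toDual ℝ (Vec N) z) θ :=
    hp.hasFDerivAt.sub (ContinuousLinearMap.hasFDerivAt _)
  have hmin : IsLocalMin (fun ξ => f ξ - InnerProductSpace.toDual ℝ (Vec N) z ξ) θ := by
    refine Eventually.of_forall fun ξ => ?_
    have := hz ξ
    simp only [InnerProductSpace.toDual_apply_apply]
    rw [real_inner_comm z ξ, real_inner_comm z θ] at *
    linarith
  have h0 := hmin.hasFDerivAt_eq_zero hd
  exact ((InnerProductSpace.toDual ℝ (Vec N)).injective (sub_eq_zero.1 h0)).symm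

theorem le_convexConjugate (f : Vec N → ℝ) (θ x : Vec N) :
    ((inner ℝ θ x - f θ : ℝ) : EReal) ≤ convexConjugate f x :=
  le_iSup (fun θ : Vec N => ((inner ℝ θ x - f θ : ℝ) : EReal)) θ

/-- The Fenchel–Young inequality. -/
theorem inner_sub_convexConjugate_le (f : Vec N → ℝ) (θ x : Vec N) :
    ((inner ℝ θ x : ℝ) : EReal) - convexConjugate f x ≤ (f θ : EReal) := by
  have h := le_convexConjugate f θ x
  generalize convexConjugate f x = c at h
  induction c with
  | bot => exact absurd (le_bot_iff.1 h) (EReal.coe_ne_bot _)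
  | top => simp
  | coe c =>
    norm_cast at h ⊢
    linarith

/-- Equality in the Fenchel–Young inequality characterizes subgradients. -/
theorem le_inner_sub_convexConjugate_iff (f : Vec N → ℝ) (θ x : Vec N) :
    (f θ : EReal) ≤ ((inner ℝ θ x : ℝ) : EReal) - convexConjugate f x ↔
      ∀ ξ, inner ℝ ξ x - f ξ ≤ inner ℝ θ x - f θ := by
  have key : (∀ ξ, inner ℝ ξ x - f ξ ≤ inner ℝ θ x - f θ) ↔
      convexConjugate f x ≤ ((inner ℝ θ x - f θ : ℝ) : EReal) := by
    simp only [convexConjugate, iSup_le_iff, EReal.coe_le_coe_iff]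
  rw [key]
  have h := le_convexConjugate f θ x
  generalize convexConjugate f x = c at h
  induction c with
  | bot => exact absurd (le_bot_iff.1 h) (EReal.coe_ne_bot _)
  -- Both sides fail when the conjugate is infinite.
  | top =>
    rw [EReal.sub_top, le_bot_iff, top_le_iff]
    exact iff_of_false (EReal.coe_ne_bot _) (EReal.coe_ne_top _)
  | coe c =>
    norm_cast
    constructor <;> intro _ <;> linarith

/-- If `f` is convex and differentiable at `θ` with gradient in `S`, then the maximizer over `S`
of `⟨θ, ·⟩ - f*` is the gradient. -/
theorem isArgmax_of_hasGradientAt {f : Vec N → ℝ} (hf : ConvexOn ℝ Set.univ f) {p θ : Vec N}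
    (hp : HasGradientAt f p θ) {S : Set (Vec N)} (hpS : p ∈ S) :
    IsArgmax (fun y => ((inner ℝ θ y : ℝ) : EReal) - convexConjugate f y) S p := by
  have hsub : ∀ ξ, inner ℝ ξ p - f ξ ≤ inner ℝ θ p - f θ := fun ξ => by
    have := add_inner_le_of_hasGradientAt hf hp ξ
    rw [inner_sub_right, real_inner_comm ξ p, real_inner_comm θ p] at this
    linarith
  have hle := (le_inner_sub_convexConjugate_iff f θ p).2 hsub
  refine ⟨hpS, fun y _ => (inner_sub_convexConjugate_le f θ y).trans hle, fun z _ hz => ?_⟩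
  -- A rival maximizer `z` does at least as well as `p`, which attains the Fenchel–Young bound `f
  -- θ`; so `z` is a subgradient at `θ`.
  exact eq_of_hasGradientAt_of_subgradient hp
    ((le_inner_sub_convexConjugate_iff f θ z).1 (hle.trans (hz p hpS)))

theorem IsArgmax.unique {g : Vec N → EReal} {S : Set (Vec N)} {x y : Vec N}
    (hx : IsArgmax g S x) (hy : IsArgmax g S y) : x = y :=
  hy.2.2 x hx.1 hx.2.1

end Conjugate

/-! ### Regularity of the social surplus and its gradient -/

section Surplus

variable {N : ℕ}

theorem bddAbove_range_fin (v : Fin N → ℝ) : BddAbove (Set.range v) :=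
  (Set.finite_range v).bddAbove

theorem continuous_iSup_fin [Nonempty (Fin N)] {X : Type*} [TopologicalSpace X] {g : X → Fin N → ℝ}
    (hg : ∀ i, Continuous fun x => g x i) : Continuous fun x => ⨆ i, g x i := by
  simp_rw [← Finset.sup'_univ_eq_ciSup]
  exact Continuous.finset_sup'_apply _ fun i _ => hg i

theorem iSup_fin_sub_le [Nonempty (Fin N)] (v w : Fin N → ℝ) {c : ℝ} (h : ∀ i, v i - w i ≤ c) :
    (⨆ i, v i) - ⨆ i, w i ≤ c := by
  have : ⨆ i, v i ≤ (⨆ i, w i) + c := ciSup_le fun i => by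
    linarith [h i, le_ciSup (bddAbove_range_fin w) i]
  linarith

/-- The Lipschitz constant 1 does not depend on the shock, so it serves as the dominating function
under the integral. -/
theorem abs_iSup_sub_iSup_le [Nonempty (Fin N)] (θ ξ e : Vec N) (η : ℝ) :
    |(⨆ i, (θ i + η * e i)) - ⨆ i, (ξ i + η * e i)| ≤ ‖θ - ξ‖ := by
  have h : ∀ i, |θ i - ξ i| ≤ ‖θ - ξ‖ := fun i => by
    simpa using PiLp.norm_apply_le (θ - ξ) i
  rw [abs_le]
  constructor
  · rw [neg_le, neg_sub]
    exact iSup_fin_sub_le _ _ fun i => by linarith [(abs_le.1 (h i)).1]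
  · exact iSup_fin_sub_le _ _ fun i => by linarith [(abs_le.1 (h i)).2]

theorem continuous_iSup_payoff [Nonempty (Fin N)] (η : ℝ) :
    Continuous (Function.uncurry fun (e θ : Vec N) => ⨆ i, (θ i + η * e i)) :=
  continuous_iSup_fin (g := fun (q : Vec N × Vec N) i => q.2 i + η * q.1 i) fun i => by fun_prop

theorem integrable_iSup_payoff [Nonempty (Fin N)] {F : Measure (Vec N)}
   
    (hF : ShockAssumption F) (η : ℝ) (θ : Vec N) : Integrable (fun e : Vec N => ⨆ i, (θ i + η * e i)) F := by
  have := hF.isProbability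
  have hi : ∀ i, Integrable (fun e : Vec N => |θ i + η * e i|) F := fun i =>
    ((integrable_const _).add ((hF.integrable i).const_mul η)).abs
  refine (integrable_finsetSum Finset.univ fun i _ => hi i).mono'
    (((continuous_iSup_payoff η).comp
      (continuous_id.prodMk continuous_const)).aestronglyMeasurable) ?_
  refine Eventually.of_forall fun e => ?_
  have hle : ∀ i, |θ i + η * e i| ≤ ∑ j, |θ j + η * e j| := fun i =>
    Finset.single_le_sum (f := fun j => |θ j + η * e j|) (fun j _ => abs_nonneg _)
      (Finset.mem_univ i)
  rw [Real.norm_eq_abs, abs_le]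
  constructor
  · let i : Fin N := Classical.arbitrary _
    exact (neg_le_neg (hle i)).trans ((neg_abs_le _).trans
      (le_ciSup (bddAbove_range_fin fun i => θ i + η * e i) i))
  · exact ciSup_le fun i => (le_abs_self _).trans (hle i)

/-- A level set of a nonzero linear functional is a null set. -/
theorem measure_level_eq_zero (l : Vec N →ₗ[ℝ] ℝ) (hl : l ≠ 0) (c : ℝ) :
    (volume : Measure (Vec N)) {e | l e = c} = 0 := by
  rcases Set.eq_empty_or_nonempty {e : Vec N | l e = c} with h | ⟨a, ha⟩
  · rw [h, measure_empty]
  · have ha' : l a = c := ha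
    have : {e : Vec N | l e = c} = (fun e => -a + e) ⁻¹' (LinearMap.ker l : Set (Vec N)) := by
      ext e
      rw [Set.mem_ofPred_eq, Set.mem_preimage, SetLike.mem_coe, LinearMap.mem_ker, map_add, map_neg,
        ha', neg_add_eq_zero, eq_comm]
    rw [this, measure_preimage_add]
    exact Measure.addHaar_submodule _ _ (by simpa [LinearMap.ker_eq_top] using hl)

theorem ae_payoff_ne {F : Measure (Vec N)} (hF : ShockAssumption F) {η : ℝ} (hη : 0 < η)
    (θ : Vec N) : ∀ᵐ e ∂F, ∀ i j, i ≠ j → θ i + η * e i ≠ θ j + η * e j := by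
  refine hF.absolutelyContinuous.ae_le ?_
  change ∀ᵐ e ∂(volume : Measure (Vec N)), ∀ i j, i ≠ j → θ i + η * e i ≠ θ j + η * e j
  rw [ae_all_iff]
  intro i
  rw [ae_all_iff]
  intro j
  by_cases hij : i = j
  · simp [hij]
  let l : Vec N →ₗ[ℝ] ℝ := (EuclideanSpace.proj i - EuclideanSpace.proj j : Vec N →L[ℝ] ℝ)
  have hl : l ≠ 0 := fun h => by
    have := LinearMap.congr_fun h (EuclideanSpace.single i (1 : ℝ))
    simp [l, Ne.symm hij] at this
  -- A tie between `i` and `j` puts `e` on the hyperplane `e i - e j = (θ j - θ i) / η`.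
  refine measure_mono_null ?_ (measure_level_eq_zero l hl ((θ j - θ i) / η))
  intro e he
  simp only [Set.mem_compl_iff, Set.mem_ofPred_eq, Classical.not_imp, not_not] at he
  change e i - e j = _
  rw [eq_div_iff hη.ne']
  linarith [he.2]

/-- Without ties the best alternative is strictly best, and by continuity stays best near `θ`; there
the maximum is a single affine function. -/
theorem differentiableAt_iSup_payoff [Nonempty (Fin N)] {η : ℝ} {θ e : Vec N}
    (h : ∀ i j, i ≠ j → θ i + η * e i ≠ θ j + η * e j) :
    DifferentiableAt ℝ (fun ξ : Vec N => ⨆ i, (ξ i + η * e i)) θ := by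
  obtain ⟨i, hi⟩ := Finite.exists_max fun i => θ i + η * e i
  have hev : ∀ᶠ ξ : Vec N in 𝓝 θ, ∀ j, ξ j + η * e j ≤ ξ i + η * e i := by
    rw [eventually_all]
    intro j
    by_cases hij : j = i
    · simp [hij]
    · have hlt : θ j + η * e j < θ i + η * e i := lt_of_le_of_ne (hi j) (h j i hij)
      have h1 : Continuous fun ξ : Vec N => ξ j + η * e j := by fun_prop
      have h2 : Continuous fun ξ : Vec N => ξ i + η * e i := by fun_prop
      exact (h1.continuousAt.eventually_lt h2.continuousAt hlt).mono fun ξ h => h.le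
  have hd : DifferentiableAt ℝ (fun ξ : Vec N => ξ i + η * e i) θ := by fun_prop
  refine hd.congr_of_eventuallyEq (hev.mono fun ξ hξ => ?_)
  exact le_antisymm (ciSup_le hξ) (le_ciSup (bddAbove_range_fin fun i => ξ i + η * e i) i)

theorem differentiableAt_socialSurplus [Nonempty (Fin N)] {F : Measure (Vec N)}
    (hF : ShockAssumption F) {η : ℝ}
    (hη : 0 < η) (θ : Vec N) : DifferentiableAt ℝ (socialSurplus F η) θ := by
  have := hF.isProbability
  -- `fderiv` takes its default value 0 where the maximum is not differentiable; this happens only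
  -- on a null set and does not spoil measurability.
  refine (hasFDerivAt_integral_of_dominated_loc_of_lip (𝕜 := ℝ) (μ := F)
    (F := fun (θ e : Vec N) => ⨆ i, (θ i + η * e i)) (x₀ := θ) (s := Set.univ)
    (F' := fun e => fderiv ℝ (fun ξ : Vec N => ⨆ i, (ξ i + η * e i)) θ) (bound := fun _ => 1)
    univ_mem ?_ (integrable_iSup_payoff hF η θ) ?_ ?_ (integrable_const _) ?_).2.differentiableAt
  · exact Eventually.of_forall fun ξ => (integrable_iSup_payoff hF η ξ).aestronglyMeasurable
  · exact ((measurable_fderiv_with_param ℝ (continuous_iSup_payoff η)).comp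
      (measurable_id.prodMk measurable_const)).aestronglyMeasurable
  · refine Eventually.of_forall fun e => LipschitzOnWith.of_dist_le_mul fun ξ _ ζ _ => ?_
    simpa [Real.dist_eq, dist_eq_norm] using abs_iSup_sub_iSup_le ξ ζ e η
  · exact (ae_payoff_ne hF hη θ).mono fun e he => (differentiableAt_iSup_payoff he).hasFDerivAt

theorem convexOn_socialSurplus [Nonempty (Fin N)] {F : Measure (Vec N)}
    (hF : ShockAssumption F) (η : ℝ) :
    ConvexOn ℝ Set.univ (socialSurplus F η) := by
  refine ⟨convex_univ, fun θ _ ξ _ a b ha hb hab => ?_⟩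
  have hθ := (integrable_iSup_payoff hF η θ).const_mul a
  have hξ := (integrable_iSup_payoff hF η ξ).const_mul b
  simp only [socialSurplus, smul_eq_mul]
  rw [← integral_const_mul, ← integral_const_mul, ← integral_add hθ hξ]
  refine integral_mono (integrable_iSup_payoff hF η _) (hθ.add hξ) fun e => ciSup_le fun i => ?_
  have h1 := mul_le_mul_of_nonneg_left (le_ciSup (bddAbove_range_fin fun i => θ i + η * e i) i) ha
  have h2 := mul_le_mul_of_nonneg_left (le_ciSup (bddAbove_range_fin fun i => ξ i + η * e i) i) hb
  have h3 : (a • θ + b • ξ) i + η * e i = a * (θ i + η * e i) + b * (ξ i + η * e i) := by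
    simp only [PiLp.add_apply, PiLp.smul_apply, smul_eq_mul]
    linear_combination (-(η * e i)) * hab
  rw [h3]
  exact add_le_add h1 h2

/-- Covers both monotonicity (`c = 0`) and the effect of a common shift of all payoffs by `c`. -/
theorem socialSurplus_le_add [Nonempty (Fin N)] {F : Measure (Vec N)}
    (hF : ShockAssumption F) (η : ℝ)
    {θ ξ : Vec N} {c : ℝ} (h : ∀ i, ξ i ≤ θ i + c) :
    socialSurplus F η ξ ≤ socialSurplus F η θ + c := by
  have := hF.isProbability
  have hθ := integrable_iSup_payoff hF η θ
  have hc : ∫ _ : Vec N, c ∂F = c := by simp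
  simp only [socialSurplus]
  rw [← hc, ← integral_add hθ (integrable_const c)]
  refine integral_mono (integrable_iSup_payoff hF η _) (hθ.add (integrable_const c)) fun e => ?_
  have := iSup_fin_sub_le (fun i => ξ i + η * e i) (fun i => θ i + η * e i) (c := c)
    fun i => by linarith [h i]
  simp only at this ⊢
  linarith

/-- Gradients of the social surplus function are choice probabilities. -/
theorem mem_simplex_of_hasGradientAt [Nonempty (Fin N)] {F : Measure (Vec N)}
    (hF : ShockAssumption F) {η : ℝ}
    {p θ : Vec N} (hp : HasGradientAt (socialSurplus F η) p θ) : p ∈ simplex N := by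
  have hsub := add_inner_le_of_hasGradientAt (convexOn_socialSurplus hF η) hp
  -- A common shift by `c` raises the surplus by at most `c`; the choices `c = 1` and `c = -1` force
  -- total mass 1.
  have hconst : ∀ c : ℝ, c * ∑ i, p i ≤ c := fun c => by
    have h1 := hsub (θ + WithLp.toLp 2 fun _ => c)
    have h2 := socialSurplus_le_add hF η (θ := θ) (ξ := θ + WithLp.toLp 2 fun _ => c) (c := c)
      fun i => by simp
    rw [add_sub_cancel_left] at h1
    have h3 : inner ℝ p (WithLp.toLp 2 fun _ => c) = c * ∑ i, p i := by
      simp [PiLp.inner_apply, Finset.mul_sum]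
    linarith
  refine ⟨fun i => ?_, by linarith [hconst 1, hconst (-1)]⟩
  -- Lowering one payoff cannot raise the surplus, so `-p i ≤ 0`.
  have h1 := hsub (θ - EuclideanSpace.single i (1 : ℝ))
  have h2 := socialSurplus_le_add hF η (θ := θ) (ξ := θ - EuclideanSpace.single i (1 : ℝ)) (c := 0)
    fun j => by
      by_cases h : j = i <;> simp [h]
  have h3 : inner ℝ p (θ - EuclideanSpace.single i (1 : ℝ) - θ) = - p i := by
    rw [sub_sub_cancel_left, inner_neg_right, EuclideanSpace.inner_single_right]
    simp
  linarith

theorem socialSurplus_smul (F : Measure (Vec N)) {η : ℝ} (hη : 0 < η) (θ : Vec N) :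
    socialSurplus F η (η • θ) = η * socialSurplus F 1 θ := by
  simp only [socialSurplus]
  rw [← integral_const_mul]
  congr 1
  funext e
  rw [Real.mul_iSup_of_nonneg hη.le]
  congr 1
  funext i
  simp [mul_add]

/-- The regularizer is the convex conjugate of the social surplus function. -/
theorem regularizer_eq_convexConjugate (F : Measure (Vec N)) {η : ℝ} (hη : 0 < η) (x : Vec N) :
    regularizer F η x = convexConjugate (socialSurplus F η) x := by
  -- The substitution `θ ↦ η • θ` reindexes the supremum, and positive homogeneity absorbs the
  -- factor `η`.
  have hs : Function.Surjective fun θ : Vec N => η • θ := fun θ =>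
    ⟨η⁻¹ • θ, smul_inv_smul₀ hη.ne' θ⟩
  rw [regularizer, convexConjugate, convexConjugate, coe_mul_iSup hη,
    ← hs.iSup_comp (g := fun θ => ((inner ℝ θ x - socialSurplus F η θ : ℝ) : EReal))]
  congr 1
  funext θ
  rw [socialSurplus_smul F hη, real_inner_smul_left, ← EReal.coe_mul, mul_sub]

theorem hasGradientAt_socialSurplus_iff [Nonempty (Fin N)] {F : Measure (Vec N)}
    (hF : ShockAssumption F) {η : ℝ}
    (hη : 0 < η) (θ x : Vec N) :
    HasGradientAt (socialSurplus F η) x θ ↔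
      IsArgmax (fun y => ((inner ℝ θ y : ℝ) : EReal) - regularizer F η y) (simplex N) x := by
  simp only [regularizer_eq_convexConjugate F hη]
  have key : ∀ {p}, HasGradientAt (socialSurplus F η) p θ → IsArgmax
      (fun y => ((inner ℝ θ y : ℝ) : EReal) - convexConjugate (socialSurplus F η) y)
      (simplex N) p := fun hp =>
    isArgmax_of_hasGradientAt (convexOn_socialSurplus hF η) hp (mem_simplex_of_hasGradientAt hF hp)
  refine ⟨key, fun hx => ?_⟩
  -- The gradient exists and is itself the argmax, so uniqueness identifies it with `x`.
  have hg := (differentiableAt_socialSurplus hF hη θ).hasGradientAt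
  rwa [hx.unique (key hg)]

theorem isSSARun_iff_isFTRLRun [Nonempty (Fin N)] {F : Measure (Vec N)}
    (hF : ShockAssumption F) {η : ℝ}
    (hη : 0 < η) (T : ℕ) (u x : ℕ → Vec N) :
    IsSSARun F η T u x ↔ IsFTRLRun (regularizer F η) T u x := by
  have h0 := hasGradientAt_socialSurplus_iff hF hη 0 (x 1)
  simp only [inner_zero_left, EReal.coe_zero, zero_sub] at h0
  have h := fun t => hasGradientAt_socialSurplus_iff hF hη (cumPayoff u t) (x (t + 1))
  exact ⟨fun hx => ⟨h0.1 hx.init, fun t h1 hT => (h t).1 (hx.step t h1 hT)⟩,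
    fun hx => ⟨h0.2 hx.init, fun t h1 hT => (h t).2 (hx.step t h1 hT)⟩⟩

theorem IsSSARun.unique {F : Measure (Vec N)} {η : ℝ} {T : ℕ} {u x y : ℕ → Vec N}
    (hx : IsSSARun F η T u x) (hy : IsSSARun F η T u y) {t : ℕ} (h1 : 1 ≤ t) (hT : t ≤ T + 1) :
    x t = y t := by
  obtain ⟨s, rfl⟩ := Nat.exists_eq_add_of_le' h1
  rcases Nat.eq_zero_or_pos s with rfl | hs
  · exact hx.init.unique hy.init
  · exact (hx.step s hs (by omega)).unique (hy.step s hs (by omega))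

theorem isSSARun_gradient [Nonempty (Fin N)] {F : Measure (Vec N)}
    (hF : ShockAssumption F) {η : ℝ} (hη : 0 < η)
    (T : ℕ) (u : ℕ → Vec N) :
    -- Choices lag payoffs by one period: index 1 uses `cumPayoff u 0 = 0`. The truncated value at
    -- index 0 plays no role.
    IsSSARun F η T u fun t => gradient (socialSurplus F η) (cumPayoff u (t - 1)) :=
  ⟨(differentiableAt_socialSurplus hF hη _).hasGradientAt,
    fun t _ _ => (differentiableAt_socialSurplus hF hη (cumPayoff u t)).hasGradientAt⟩

end Surplus

end

end RUMODP

theorem mainTheorem6 (N : ℕ) (hN : 1 ≤ N) (T : ℕ)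
    (F : MeasureTheory.Measure (RUMODP.Vec N)) (hF : RUMODP.ShockAssumption F)
    (η L : ℝ) (hη : 0 < η) (hL : 0 < L)
    (u : ℕ → RUMODP.Vec N) (hH : RUMODP.HessianAssumption F η L T u) :
    -- the regularizer is the convex conjugate of the social surplus function
    (∀ x, RUMODP.regularizer F η x =
        RUMODP.convexConjugate (RUMODP.socialSurplus F η) x) ∧
    -- both algorithms are well defined and have a common run
    (∃ x : ℕ → RUMODP.Vec N, RUMODP.IsSSARun F η T u x ∧
        RUMODP.IsFTRLRun (RUMODP.regularizer F η) T u x) ∧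
    -- the runs of one are exactly the runs of the other
    (∀ x : ℕ → RUMODP.Vec N, RUMODP.IsSSARun F η T u x ↔
        RUMODP.IsFTRLRun (RUMODP.regularizer F η) T u x) ∧
    -- the two algorithms produce the same sequence of choice probabilities
    (∀ x y : ℕ → RUMODP.Vec N, RUMODP.IsSSARun F η T u x →
        RUMODP.IsFTRLRun (RUMODP.regularizer F η) T u y →
        ∀ t, 1 ≤ t → t ≤ T + 1 → x t = y t) := by
  have : Nonempty (Fin N) := ⟨⟨0, hN⟩⟩
  have hiff := RUMODP.isSSARun_iff_isFTRLRun hF hη T u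
  have hrun := RUMODP.isSSARun_gradient hF hη T u
  exact ⟨RUMODP.regularizer_eq_convexConjugate F hη, ⟨_, hrun, (hiff _).1 hrun⟩, hiff,
    fun x y hx hy t h1 hT => hx.unique ((hiff y).2 hy) h1 hT⟩
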